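/- Let $K$ be an arbitrary field and let $\lambda=(r,r,\ldots,r)$ be a rectangular partition of $n$, that is, a partition with $d$ equal parts $r$, where $d,r\ge 2$ and $n=dr$. Let $T_\lambda$ be the nilpotent $n\times n$ matrix in Jordan canonical form with blocks of sizes $\lambda_1,\ldots,\lambda_d$: its entries are $1$ in the positions $(j,j+1)$ for $j\in\{1,\ldots,n-1\}\setminus\{\lambda_1,\lambda_1+\lambda_2,\ldots,\lambda_1+\cdots+\lambda_{d-1}\}$, and $0$ elsewhere. It acts on row vectors in $K^n$ from the right. For $0\le\ell\le n$ consider the variety $$\mathrm{Gr}(\ell,n)^{T_\lambda}=\{L\in\mathrm{Gr}(\ell,n)\,:\,L\,T_\lambda\subseteq L\}\subseteq\mathbb{P}^{\binom n\ell-1}$$ of $T_\lambda$-stable $\ell$-dimensional subspaces, embedded by Plücker coordinates. Then $\mathrm{Gr}(\ell,n)^{T_\lambda}$ is irreducible. Precisely: its set of points over the algebraic closure $\overline K$ is irreducible (in particular non-empty) in the Zariski topology of $\mathbb{P}^{\binom n\ell-1}(\overline K)$; and if $K$ is infinite, its set of $K$-rational points is irreducible in the Zariski topology of $\mathbb{P}^{\binom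 n\ell-1}(K)$. -/

import Mathlib

/-! ### Projective space over a field, with its Zariski topology -/

/-- The set of points of the projective space `ℙ(K^σ)` at which all polynomials of `S` vanish.
It is only used for sets `S` of homogeneous polynomials, where vanishing at a point does not depend
on the representative. -/
def projZeroLocus {K σ : Type*} [Field K] (S : Set (MvPolynomial σ K)) :
    Set (Projectivization K (σ → K)) :=
  {x | ∀ f ∈ S, MvPolynomial.eval x.rep f = 0}

/-- Zariski closed subsets of `ℙ(K^σ)`: the zero loci of sets of homogeneous polynomials. -/
def IsZariskiClosed {K σ : Type*} [Field K] (Z : Set (Projectivization K (σ → K))) : Prop :=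
  ∃ S : Set (MvPolynomial σ K), (∀ f ∈ S, ∃ m : ℕ, f.IsHomogeneous m) ∧ Z = projZeroLocus S

theorem isZariskiClosed_union {K σ : Type*} [Field K] {Y Z : Set (Projectivization K (σ → K))}
    (hY : IsZariskiClosed Y) (hZ : IsZariskiClosed Z) : IsZariskiClosed (Y ∪ Z) := by
  obtain ⟨S, hS, rfl⟩ := hY
  obtain ⟨S', hS', rfl⟩ := hZ
  refine ⟨Set.image2 (fun f g => f * g) S S', ?_, ?_⟩
  · rintro _ ⟨f, hf, g, hg, rfl⟩
    obtain ⟨a, ha⟩ := hS f hf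
    obtain ⟨b, hb⟩ := hS' g hg
    exact ⟨a + b, ha.mul hb⟩
  · ext x
    simp only [projZeroLocus, Set.mem_union, Set.mem_ofPred_eq]
    constructor
    · rintro (h | h) _ ⟨f, hf, g, hg, rfl⟩
      · simp [h f hf]
      · simp [h g hg]
    · intro h
      by_contra hc
      push Not at hc
      obtain ⟨⟨f, hf, hf0⟩, ⟨g, hg, hg0⟩⟩ := hc
      have := h _ ⟨f, hf, g, hg, rfl⟩
      simp only [map_mul, mul_eq_zero] at this
      tauto

/-- The Zariski topology on the set of `K`-points `ℙ(K^σ)` of projective space. -/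
instance zariskiTopologicalSpace {K σ : Type*} [Field K] :
    TopologicalSpace (Projectivization K (σ → K)) :=
  TopologicalSpace.ofClosed {Z | IsZariskiClosed Z}
    ⟨{1}, by
      rintro f rfl
      exact ⟨0, MvPolynomial.isHomogeneous_one σ K⟩, by
      ext x
      simp [projZeroLocus]⟩
    (by
      intro A hA
      refine ⟨{f | (∃ m : ℕ, f.IsHomogeneous m) ∧ ∃ Z ∈ A, ∀ x ∈ Z,
        MvPolynomial.eval (Projectivization.rep x) f = 0}, fun f hf => hf.1, ?_⟩
      ext x
      constructor
      · rintro hx f ⟨-, Z, hZ, hf⟩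
        exact hf x (hx Z hZ)
      · intro hx Z hZ
        obtain ⟨S, hS, rfl⟩ := hA hZ
        exact fun f hf => hx f ⟨hS f hf, _, hZ, fun y hy => hy f hf⟩)
    (fun _ hY _ hZ => isZariskiClosed_union hY hZ)

/-! ### The Grassmannian in its Plücker embedding -/

/-- The Grassmannian of `ℓ`-dimensional linear subspaces of the space of row vectors `K^n`. -/
def Gr (K : Type*) [Field K] (ℓ n : ℕ) : Type _ :=
  {L : Submodule K (Fin n → K) // Module.finrank K L = ℓ}

/-- The vector of maximal minors of an `ℓ × n` matrix, indexed by the increasing sequences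
`i₁ < ⋯ < i_ℓ` of column indices. -/
def maximalMinors {K : Type*} [Field K] {ℓ n : ℕ} (M : Matrix (Fin ℓ) (Fin n) K) :
    (Fin ℓ ↪o Fin n) → K :=
  fun I => (M.submatrix id I).det

theorem maximalMinors_ne_zero {K : Type*} [Field K] {ℓ n : ℕ} (M : Matrix (Fin ℓ) (Fin n) K)
    (hM : LinearIndependent K M.row) : maximalMinors M ≠ 0 := by
  classical
  have hrank : M.rank = ℓ := by
    rw [hM.rank_matrix, Fintype.card_fin]
  have hspan : Submodule.span K (Set.range M.col) = ⊤ := by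
    apply Submodule.eq_top_of_finrank_eq
    rw [← Matrix.rank_eq_finrank_span_cols, hrank]
    simp
  obtain ⟨κ, a, ha, hsp, hli⟩ := exists_linearIndependent' K M.col
  rw [hspan] at hsp
  have : Finite κ := Finite.of_injective a ha
  have : Fintype κ := Fintype.ofFinite κ
  have hcard : Fintype.card κ = ℓ := by
    have h := finrank_span_eq_card hli
    rw [hsp] at h
    simpa using h.symm
  have hs : (Finset.univ.image a).card = ℓ := by
    rw [Finset.card_image_of_injective _ ha, Finset.card_univ, hcard]
  let I : Fin ℓ ↪o Fin n := (Finset.univ.image a).orderEmbOfFin hs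
  have hI : ∀ j, ∃ k, a k = I j := by
    intro j
    obtain ⟨k, -, hk⟩ := Finset.mem_image.1
      (Finset.orderEmbOfFin_mem (Finset.univ.image a) hs j)
    exact ⟨k, hk⟩
  choose b hb using hI
  have hbinj : Function.Injective b := by
    intro i j hij
    apply I.injective
    rw [← hb, ← hb, hij]
  have hli2 : LinearIndependent K (M.submatrix id I).col := by
    have h := hli.comp b hbinj
    have he : (M.submatrix id I).col = (M.col ∘ a) ∘ b := by
      funext j i
      change M i (I j) = M i (a (b j))
      rw [hb]
    rw [he]
    exact h
  intro h0
  have hdet : (M.submatrix id I).det = 0 := congrFun h0 I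
  have hu := Matrix.linearIndependent_cols_iff_isUnit.mp hli2
  rw [Matrix.isUnit_iff_isUnit_det, hdet] at hu
  exact not_isUnit_zero hu

/-- A matrix whose rows form a basis of `L`. -/
noncomputable def Gr.basisMatrix {K : Type*} [Field K] {ℓ n : ℕ} (L : Gr K ℓ n) :
    Matrix (Fin ℓ) (Fin n) K :=
  Matrix.of fun i => ((Module.finBasisOfFinrankEq K L.1 L.2 i : L.1) : Fin n → K)

theorem Gr.linearIndependent_basisMatrix {K : Type*} [Field K] {ℓ n : ℕ} (L : Gr K ℓ n) :
    LinearIndependent K L.basisMatrix.row :=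
  (Module.finBasisOfFinrankEq K L.1 L.2).linearIndependent.map' L.1.subtype L.1.ker_subtype

theorem Gr.span_basisMatrix {K : Type*} [Field K] {ℓ n : ℕ} (L : Gr K ℓ n) :
    Submodule.span K (Set.range L.basisMatrix.row) = L.1 := by
  have h : Set.range L.basisMatrix.row
      = L.1.subtype '' Set.range (Module.finBasisOfFinrankEq K L.1 L.2) := by
    rw [← Set.range_comp]
    rfl
  rw [h, Submodule.span_image, Module.Basis.span_eq, Submodule.map_top, Submodule.range_subtype]

/-- The Plücker embedding: `L` is sent to the class of the vector of maximal minors of a matrix with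
row space `L`. -/
noncomputable def plucker {K : Type*} [Field K] {ℓ n : ℕ} (L : Gr K ℓ n) :
    Projectivization K ((Fin ℓ ↪o Fin n) → K) :=
  Projectivization.mk K (maximalMinors L.basisMatrix)
    (maximalMinors_ne_zero _ L.linearIndependent_basisMatrix)

/-- The Plücker embedding can be computed from any matrix with row space `L`. -/
theorem plucker_eq_mk {K : Type*} [Field K] {ℓ n : ℕ} (L : Gr K ℓ n)
    (M : Matrix (Fin ℓ) (Fin n) K) (hM : LinearIndependent K M.row)
    (hL : Submodule.span K (Set.range M.row) = L.1) :
    plucker L = Projectivization.mk K (maximalMinors M) (maximalMinors_ne_zero M hM) := by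
  have hmem : ∀ i, L.basisMatrix.row i ∈ Submodule.span K (Set.range M.row) := by
    intro i
    rw [hL, ← L.span_basisMatrix]
    exact Submodule.subset_span ⟨i, rfl⟩
  have hc : ∀ i, ∃ c : Fin ℓ → K, ∑ j, c j • M.row j = L.basisMatrix.row i :=
    fun i => (Submodule.mem_span_range_iff_exists_fun K).1 (hmem i)
  choose c hc using hc
  have hB : L.basisMatrix = Matrix.of c * M := by
    ext i k
    have := congrFun (hc i) k
    rw [Matrix.mul_apply]
    simpa [Finset.sum_apply, Matrix.row] using this.symm
  unfold plucker
  rw [Projectivization.mk_eq_mk_iff']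
  refine ⟨(Matrix.of c).det, ?_⟩
  ext I
  have : L.basisMatrix.submatrix id I = Matrix.of c * M.submatrix id I := by
    rw [hB]
    rfl
  simp [maximalMinors, this, Matrix.det_mul]

/-- The variety `Gr(ℓ,n)^T = {L ∈ Gr(ℓ,n) : L T ⊆ L}`, as a set of points of the Plücker projective
space. The matrix `T` acts on row vectors from the right. -/
def fixedLocus {K : Type*} [Field K] (ℓ : ℕ) {n : ℕ} (T : Matrix (Fin n) (Fin n) K) :
    Set (Projectivization K ((Fin ℓ ↪o Fin n) → K)) :=
  plucker '' {L : Gr K ℓ n | ∀ v ∈ L.1, Matrix.vecMul v T ∈ L.1}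

/-! ### Nilpotent matrices in Jordan form -/

open Classical in
/-- The nilpotent `n × n` matrix `T_λ` in Jordan form, whose blocks have sizes
`λ₁ ≥ λ₂ ≥ ⋯ ≥ λ_s`. With rows and columns numbered from 1, it has an entry 1 at the positions
`(j, j + 1)` with `j` not a partial sum `λ₁ + ⋯ + λ_k`, and entries 0 elsewhere.
(Here `i : Fin n` is the row number `i + 1`.) -/
noncomputable def jordanNilpotent (K : Type*) [Field K] {n : ℕ} (lam : n.Partition) :
    Matrix (Fin n) (Fin n) K :=
  Matrix.of fun i j =>
    if (j : ℕ) = i + 1 ∧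
        ∀ k : ℕ, (i : ℕ) + 1 ≠ ((lam.parts.sort (fun a b => a ≥ b)).take k).sum
    then 1 else 0

/-- Rectangular partitions `(r, r, …, r)` with `d` parts, where `d, r ≥ 2`. -/
def IsRectangular {n : ℕ} (lam : n.Partition) : Prop :=
  ∃ d r : ℕ, 2 ≤ d ∧ 2 ≤ r ∧ lam.parts = Multiset.replicate d r

/-! ### Polynomial families of points of projective space -/

/-! Since all blocks have size `r`, `K^n` is a free module of rank `d` over `K[X]/(X^r)`, and stable
subspaces are its submodules. By Smith normal form each is spanned by Jordan chains of some Jordan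
basis `e`, with chain `i` started at `τ ^ a i` (`exists_eq_truncSpan`); its row lengths `r - a i`
sum to `ℓ`. Generic subspaces fill the rows greedily: full rows, at most one partial row, then empty
rows. They are row spaces of matrices depending linearly on free vectors, so they lie in a
polynomial image of affine space, which is irreducible over an infinite field and consists of stable
subspaces (`polynomialImage_chainMinors_subset`). Every other type is a limit: replacing `τ ^ a j (e
j)` by `τ ^ a j (e j) + c • τ ^ (a i - 1) (e i)` moves one box from row `j` to row `i` for all `c ≠
0`. Induction on the type puts every stable subspace in the closure of the generic family
(`plucker_mem_of_eq_truncSpan`). Only infinitude of the field is used, so the argument covers both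
`K` and its algebraic closure. -/

theorem MvPolynomial.IsHomogeneous.eval_smul_eq {K σ : Type*} [Field K] {f : MvPolynomial σ K}
    {m : ℕ} (hf : f.IsHomogeneous m) (c : K) (v : σ → K) :
    MvPolynomial.eval (c • v) f = c ^ m * MvPolynomial.eval v f := by
  rw [MvPolynomial.eval_eq, MvPolynomial.eval_eq, Finset.mul_sum]
  refine Finset.sum_congr rfl fun s hs => ?_
  have hdeg : ∑ i ∈ s.support, s i = m := by
    have h := hf (MvPolynomial.mem_support_iff.1 hs)
    change s.degree = m
    rw [Finsupp.degree_eq_weight_one]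
    exact h
  simp only [Pi.smul_apply, smul_eq_mul, mul_pow, Finset.prod_mul_distrib,
    Finset.prod_pow_eq_pow_sum, hdeg]
  ring

theorem MvPolynomial.IsHomogeneous.eval_rep_mk_eq_zero_iff {K σ : Type*} [Field K]
    {f : MvPolynomial σ K} {m : ℕ} (hf : f.IsHomogeneous m) {v : σ → K} (hv : v ≠ 0) :
    MvPolynomial.eval (Projectivization.mk K v hv).rep f = 0 ↔ MvPolynomial.eval v f = 0 := by
  obtain ⟨c, hc⟩ := Projectivization.exists_smul_eq_mk_rep K v hv
  rw [← hc, Units.smul_def, hf.eval_smul_eq]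
  simp

theorem isClosed_iff_isZariskiClosed {K σ : Type*} [Field K]
    {Z : Set (Projectivization K (σ → K))} : IsClosed Z ↔ IsZariskiClosed Z := by
  rw [← isOpen_compl_iff]
  change IsZariskiClosed Zᶜᶜ ↔ _
  rw [compl_compl]

/-- The set of points of projective space with homogeneous coordinates given by the values of a
vector of polynomials. -/
def polynomialImage {K σ ι : Type*} [Field K] (φ : ι → MvPolynomial σ K) :
    Set (Projectivization K (ι → K)) :=
  {x | ∃ (v : σ → K) (h : (fun i => MvPolynomial.eval v (φ i)) ≠ 0), x = Projectivization.mk K _ h}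

/-- Basic open sets form a basis: some defining equation of the complement fails at the point, and
its nonvanishing locus lies in `U`. -/
theorem exists_isHomogeneous_of_mem_isOpen {K σ : Type*} [Field K]
    {U : Set (Projectivization K (σ → K))} (hU : IsOpen U) {v : σ → K} (hv : v ≠ 0)
    (hvU : Projectivization.mk K v hv ∈ U) :
    ∃ f : MvPolynomial σ K, MvPolynomial.eval v f ≠ 0 ∧
      ∀ (w : σ → K) (hw : w ≠ 0), MvPolynomial.eval w f ≠ 0 → Projectivization.mk K w hw ∈ U := by
  obtain ⟨S, hS, hUS⟩ := isClosed_iff_isZariskiClosed.1 hU.isClosed_compl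
  have h : Projectivization.mk K v hv ∉ projZeroLocus S := by
    rw [← hUS]
    exact fun h => h hvU
  simp only [projZeroLocus, Set.mem_ofPred_eq, not_forall] at h
  obtain ⟨f, hfS, hf⟩ := h
  obtain ⟨m, hm⟩ := hS f hfS
  rw [hm.eval_rep_mk_eq_zero_iff] at hf
  refine ⟨f, hf, fun w hw hwf => ?_⟩
  by_contra hc
  have : Projectivization.mk K w hw ∈ projZeroLocus S := hUS ▸ hc
  exact hwf ((hm.eval_rep_mk_eq_zero_iff hw).1 (this f hfS))

theorem isPreirreducible_polynomialImage {K σ ι : Type*} [Field K] [Infinite K]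
    (φ : ι → MvPolynomial σ K) : IsPreirreducible (polynomialImage φ) := by
  rintro U₁ U₂ hU₁ hU₂ ⟨_, ⟨v₁, h₁, rfl⟩, hx₁⟩ ⟨_, ⟨v₂, h₂, rfl⟩, hx₂⟩
  obtain ⟨f₁, hf₁, hf₁'⟩ := exists_isHomogeneous_of_mem_isOpen hU₁ h₁ hx₁
  obtain ⟨f₂, hf₂, hf₂'⟩ := exists_isHomogeneous_of_mem_isOpen hU₂ h₂ hx₂
  obtain ⟨i, hi⟩ := Function.ne_iff.1 h₁
  have key : ∀ (v : σ → K) (f : MvPolynomial ι K),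
      MvPolynomial.eval v (MvPolynomial.aeval φ f)
        = MvPolynomial.eval (fun i => MvPolynomial.eval v (φ i)) f := by
    intro v f
    rw [MvPolynomial.aeval_def, MvPolynomial.hom_eval₂]
    have : (MvPolynomial.eval v).comp (algebraMap K (MvPolynomial σ K)) = RingHom.id K := by
      ext; simp
    rw [this]
    rfl
  -- The polynomial ring is a domain and `K` is infinite, so the product is nonzero at some `v`. The
  -- factor `φ i` ensures that `v` defines a projective point.
  have hg : MvPolynomial.aeval φ f₁ * MvPolynomial.aeval φ f₂ * φ i ≠ 0 := by
    refine mul_ne_zero (mul_ne_zero ?_ ?_) ?_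
    · intro h
      exact hf₁ (by rw [← key, h, map_zero])
    · intro h
      exact hf₂ (by rw [← key, h, map_zero])
    · intro h
      exact hi (by simp [h])
  obtain ⟨v, hv⟩ : ∃ v, MvPolynomial.eval v
      (MvPolynomial.aeval φ f₁ * MvPolynomial.aeval φ f₂ * φ i) ≠ 0 := by
    by_contra! hc
    exact hg (MvPolynomial.funext fun v => by rw [hc, map_zero])
  rw [map_mul, map_mul, key, key] at hv
  have hv0 : (fun i => MvPolynomial.eval v (φ i)) ≠ 0 :=
    fun h => right_ne_zero_of_mul hv (congrFun h i)
  exact ⟨_, ⟨v, hv0, rfl⟩, hf₁' _ hv0 (left_ne_zero_of_mul (left_ne_zero_of_mul hv)),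
    hf₂' _ hv0 (right_ne_zero_of_mul (left_ne_zero_of_mul hv))⟩

/-- A closed set containing the points of a polynomial curve with nonzero parameter contains the
point with parameter zero. -/
theorem mk_eval_zero_mem_of_isClosed {K ι : Type*} [Field K] [Infinite K]
    {Z : Set (Projectivization K (ι → K))} (hZ : IsClosed Z) (φ : ι → Polynomial K)
    (h0 : (fun i => (φ i).eval 0) ≠ 0)
    (hφ : ∀ c : K, c ≠ 0 → ∀ h : (fun i => (φ i).eval c) ≠ 0, Projectivization.mk K _ h ∈ Z) :
    Projectivization.mk K _ h0 ∈ Z := by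
  obtain ⟨i, hi⟩ := Function.ne_iff.1 h0
  by_contra hc
  obtain ⟨f, hf, hf'⟩ := exists_isHomogeneous_of_mem_isOpen hZ.isOpen_compl h0 hc
  have key : ∀ c : K, (MvPolynomial.aeval φ f).eval c
      = MvPolynomial.eval (fun i => (φ i).eval c) f := by
    intro c
    rw [← Polynomial.coe_evalRingHom, MvPolynomial.aeval_def, MvPolynomial.hom_eval₂]
    have : (Polynomial.evalRingHom c).comp (algebraMap K (Polynomial K)) = RingHom.id K := by
      ext; simp
    rw [this]
    rfl
  -- The factor `X` excludes the parameter zero. A parameter where this product is nonzero would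
  -- give a point both in `Z` and outside it.
  have hg : MvPolynomial.aeval φ f * φ i * Polynomial.X ≠ 0 := by
    refine mul_ne_zero (mul_ne_zero ?_ ?_) Polynomial.X_ne_zero
    · intro h
      exact hf (by rw [← key, h, Polynomial.eval_zero])
    · intro h
      exact hi (by simp [h])
  refine hg (Polynomial.funext fun c => ?_)
  simp only [Polynomial.eval_mul, Polynomial.eval_X, Polynomial.eval_zero, key]
  by_contra hne
  have hφc : (fun i => (φ i).eval c) ≠ 0 :=
    fun h => right_ne_zero_of_mul (left_ne_zero_of_mul hne) (congrFun h i)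
  exact hf' _ hφc (left_ne_zero_of_mul (left_ne_zero_of_mul hne))
    (hφ c (right_ne_zero_of_mul hne) hφc)

/-! ### Limits of lines of bases and polynomial families of row spaces -/

theorem linearIndependent_row_of_maximalMinors_ne_zero {K : Type*} [Field K] {ℓ n : ℕ}
    {M : Matrix (Fin ℓ) (Fin n) K} (h : maximalMinors M ≠ 0) : LinearIndependent K M.row := by
  obtain ⟨I, hI⟩ := Function.ne_iff.1 h
  have hu : LinearIndependent K (M.submatrix id I).row :=
    Matrix.linearIndependent_rows_iff_isUnit.2
      ((Matrix.isUnit_iff_isUnit_det _).2 (isUnit_iff_ne_zero.2 hI))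
  exact LinearIndependent.of_comp (LinearMap.funLeft K K I) hu

/-- If a family of vectors `u + c w` spans for all `c ≠ 0` a space in a closed subset of the
Grassmannian, then so does `u`. -/
theorem plucker_mem_of_line {K : Type*} [Field K] [Infinite K] {ℓ n : ℕ}
    {Z : Set (Projectivization K ((Fin ℓ ↪o Fin n) → K))} (hZ : IsClosed Z)
    {ι : Type*} [Fintype ι] (hι : Fintype.card ι = ℓ) (u w : ι → Fin n → K) (L : Gr K ℓ n)
    (hL : Submodule.span K (Set.range u) = L.1)
    (hc : ∀ c : K, c ≠ 0 → ∃ L' : Gr K ℓ n,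
      Submodule.span K (Set.range (u + c • w)) = L'.1 ∧ plucker L' ∈ Z) :
    plucker L ∈ Z := by
  classical
  let σ : Fin ℓ ≃ ι := (Fintype.equivFinOfCardEq hι).symm
  have hspan : ∀ x : ι → Fin n → K, Set.range (Matrix.of (x ∘ σ)).row = Set.range x :=
    fun x => σ.surjective.range_comp x
  have hind : ∀ (x : ι → Fin n → K) (L : Gr K ℓ n), Submodule.span K (Set.range x) = L.1 →
      LinearIndependent K (Matrix.of (x ∘ σ)).row := by
    intro x L hx
    rw [linearIndependent_iff_card_eq_finrank_span, Set.finrank, hspan, hx, L.2, Fintype.card_fin]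
  -- The Plücker coordinates of `u + X w` form a polynomial curve in `X`.
  let φ : (Fin ℓ ↪o Fin n) → Polynomial K := fun I =>
    (Matrix.of fun i j : Fin ℓ =>
      Polynomial.C (u (σ i) (I j)) + Polynomial.X * Polynomial.C (w (σ i) (I j))).det
  have hφ : ∀ c : K, (fun I => (φ I).eval c) = maximalMinors (Matrix.of ((u + c • w) ∘ σ)) := by
    intro c
    ext I
    simp only [φ]
    rw [← Polynomial.coe_evalRingHom, RingHom.map_det]
    congr 1
    ext i j
    simp [mul_comm c]
  have h0 : (fun I => (φ I).eval 0) = maximalMinors (Matrix.of (u ∘ σ)) := by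
    rw [hφ]; simp
  rw [plucker_eq_mk L _ (hind u L hL) (by rw [hspan, hL])]
  simp only [← h0]
  refine mk_eval_zero_mem_of_isClosed hZ φ _ fun c hc0 h => ?_
  obtain ⟨L', hL', hmem⟩ := hc c hc0
  rw [plucker_eq_mk L' _ (hind _ L' hL') (by rw [hspan, hL'])] at hmem
  simpa only [hφ] using hmem

/-! ### Bases adapted to a nilpotent endomorphism with equal Jordan blocks -/

/-- The span of the vectors `τ ^ k (e i)` with `a i ≤ k`. -/
def truncSpan {K V : Type*} [Field K] [AddCommGroup V] [Module K V] (τ : Module.End K V) {d : ℕ}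
    (e : Fin d → V) (a : Fin d → ℕ) : Submodule K V :=
  Submodule.span K {x | ∃ i k, a i ≤ k ∧ (τ ^ k) (e i) = x}

section

variable {K V : Type*} [Field K] [AddCommGroup V] [Module K V] {τ : Module.End K V} {d r : ℕ}

theorem pow_apply_mem_truncSpan {e : Fin d → V} {a : Fin d → ℕ} {i : Fin d} {k : ℕ}
    (h : a i ≤ k) : (τ ^ k) (e i) ∈ truncSpan τ e a :=
  Submodule.subset_span ⟨i, k, h, rfl⟩

theorem truncSpan_le {e : Fin d → V} {a : Fin d → ℕ} {W : Submodule K V} :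
    truncSpan τ e a ≤ W ↔ ∀ i k, a i ≤ k → (τ ^ k) (e i) ∈ W := by
  rw [truncSpan, Submodule.span_le]
  constructor
  · exact fun h i k hk => h ⟨i, k, hk, rfl⟩
  · rintro h _ ⟨i, k, hk, rfl⟩
    exact h i k hk

theorem apply_mem_truncSpan {e : Fin d → V} {a : Fin d → ℕ} {x : V}
    (hx : x ∈ truncSpan τ e a) : τ x ∈ truncSpan τ e a := by
  have : truncSpan τ e a ≤ (truncSpan τ e a).comap τ := truncSpan_le.2 fun i k hk => by
    rw [Submodule.mem_comap, ← Module.End.mul_apply, ← pow_succ']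
    exact pow_apply_mem_truncSpan (hk.trans k.le_succ)
  exact this hx

theorem truncSpan_comp_perm (e : Fin d → V) (a : Fin d → ℕ) (σ : Equiv.Perm (Fin d)) :
    truncSpan τ (e ∘ σ) (a ∘ σ) = truncSpan τ e a := by
  apply le_antisymm
  · exact truncSpan_le.2 fun i k hk => pow_apply_mem_truncSpan hk
  · refine truncSpan_le.2 fun i k hk => ?_
    have : (τ ^ k) ((e ∘ σ) (σ.symm i)) ∈ truncSpan τ (e ∘ σ) (a ∘ σ) :=
      pow_apply_mem_truncSpan (by simpa using hk)
    simpa using this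

theorem pow_apply_eq_zero (hτ : τ ^ r = 0) {k : ℕ} (hk : r ≤ k) (x : V) : (τ ^ k) x = 0 := by
  rw [pow_eq_zero_of_le hk hτ, LinearMap.zero_apply]

theorem truncSpan_eq_span_range (hτ : τ ^ r = 0) (e : Fin d → V) (a : Fin d → ℕ) :
    truncSpan τ e a = Submodule.span K (Set.range
      fun p : {p : Fin d × Fin r // a p.1 ≤ p.2} => (τ ^ (p.1.2 : ℕ)) (e p.1.1)) := by
  apply le_antisymm
  · refine truncSpan_le.2 fun i k hk => ?_
    by_cases hkr : k < r
    · exact Submodule.subset_span ⟨⟨(i, ⟨k, hkr⟩), hk⟩, rfl⟩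
    · rw [pow_apply_eq_zero hτ (not_lt.1 hkr)]
      exact zero_mem _
  · rw [Submodule.span_le]
    rintro _ ⟨p, rfl⟩
    exact pow_apply_mem_truncSpan p.2

theorem card_le_snd (a : Fin d → ℕ) :
    Fintype.card {p : Fin d × Fin r // a p.1 ≤ p.2} = ∑ i, (r - a i) := by
  rw [Fintype.card_subtype, Finset.card_filter, Fintype.sum_prod_type]
  refine Finset.sum_congr rfl fun i _ => ?_
  rw [Fin.sum_univ_eq_sum_range (fun k => if a i ≤ k then 1 else 0) r, ← Finset.card_filter]
  have : {k ∈ Finset.range r | a i ≤ k} = Finset.Ico (a i) r := by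
    ext k; simp [and_comm]
  rw [this, Nat.card_Ico]

/-- These `d * r` vectors span a space of dimension `d * r`. Thus `truncSpan τ e 0 = ⊤` encodes that
`e` generates a Jordan basis. -/
theorem linearIndependent_pow_apply [FiniteDimensional K V] (hτ : τ ^ r = 0)
    (hV : Module.finrank K V = d * r) {e : Fin d → V} (he : truncSpan τ e 0 = ⊤) :
    LinearIndependent K fun p : Fin d × Fin r => (τ ^ (p.2 : ℕ)) (e p.1) := by
  refine linearIndependent_of_top_le_span_of_card_eq_finrank ?_ (by simp [hV])
  rw [← he, truncSpan_eq_span_range hτ]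
  refine Submodule.span_mono ?_
  rintro _ ⟨p, rfl⟩
  exact ⟨p.1, rfl⟩

theorem finrank_truncSpan [FiniteDimensional K V] (hτ : τ ^ r = 0)
    (hV : Module.finrank K V = d * r) {e : Fin d → V} (he : truncSpan τ e 0 = ⊤)
    (a : Fin d → ℕ) : Module.finrank K (truncSpan τ e a) = ∑ i, (r - a i) := by
  rw [truncSpan_eq_span_range hτ, finrank_span_eq_card, card_le_snd]
  exact (linearIndependent_pow_apply hτ hV he).comp _ Subtype.val_injective

/-- The elementary divisor theorem: a stable subspace is spanned by truncations of the Jordan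
chains of a suitable Jordan basis. -/
theorem exists_eq_truncSpan (hτ : τ ^ r = 0) {e₀ : Fin d → V} (he₀ : truncSpan τ e₀ 0 = ⊤)
    (L : Submodule K V) (hL : ∀ x ∈ L, τ x ∈ L) :
    ∃ (e : Fin d → V) (a : Fin d → ℕ), truncSpan τ e 0 = ⊤ ∧ (∀ i, a i ≤ r) ∧
      L = truncSpan τ e a := by
  -- Present `V` as a quotient of `K[X]^d` with `X` acting as `τ`; `N` below is the preimage of `L`,
  -- a submodule of a free module over a PID.
  let π : (Fin d → Polynomial K) →ₗ[K] V :=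
    { toFun := fun f => ∑ i, Polynomial.aeval τ (f i) (e₀ i)
      map_add' := fun f g => by simp [Finset.sum_add_distrib]
      map_smul' := fun c f => by simp [Finset.smul_sum] }
  have hπ : ∀ (p : Polynomial K) f, π (p • f) = Polynomial.aeval τ p (π f) := by
    intro p f
    simp [π, map_sum]
  have hstab : ∀ W : Submodule K V, (∀ x ∈ W, τ x ∈ W) → ∀ (p : Polynomial K), ∀ x ∈ W,
      Polynomial.aeval τ p x ∈ W := by
    intro W hW p x hx
    induction p using Polynomial.induction_on' with
    | add p q hp hq => simpa using W.add_mem hp hq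
    | monomial k c =>
      rw [Polynomial.aeval_monomial, Module.End.mul_apply, Module.algebraMap_end_apply]
      refine W.smul_mem _ ?_
      induction k with
      | zero => simpa
      | succ k ih => rw [pow_succ', Module.End.mul_apply]; exact hW _ ih
  have hsurj : Function.Surjective π := by
    rw [← LinearMap.range_eq_top, eq_top_iff, ← he₀]
    refine truncSpan_le.2 fun i k _ => ⟨Pi.single i (Polynomial.X ^ k), ?_⟩
    change ∑ j, Polynomial.aeval τ ((Pi.single i (Polynomial.X ^ k) : Fin d → Polynomial K) j)
      (e₀ j) = _
    rw [Finset.sum_eq_single i]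
    · simp
    · intro j _ hj
      simp [hj]
    · simp
  let N : Submodule (Polynomial K) (Fin d → Polynomial K) :=
    { carrier := {f | π f ∈ L}
      add_mem' := fun {f g} hf hg => by
        simpa only [Set.mem_ofPred_eq, map_add] using L.add_mem hf hg
      zero_mem' := by simp
      smul_mem' := fun p f hf => by
        simpa only [Set.mem_ofPred_eq, hπ] using hstab L hL p _ hf }
  have hN : ∀ f, f ∈ N ↔ π f ∈ L := fun f => Iff.rfl
  obtain ⟨m, snf⟩ := N.smithNormalForm (Pi.basisFun (Polynomial K) (Fin d))
  have hXN : ∀ f, (Polynomial.X ^ r : Polynomial K) • f ∈ N := by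
    intro f
    rw [hN, hπ, map_pow, Polynomial.aeval_X, hτ]
    exact L.zero_mem
  -- As `N` contains `X ^ r` times everything, it has full rank and its elementary divisors divide
  -- `X ^ r`, hence are powers of `X` up to units.
  have hk : ∀ j, ∃ k ≤ r, (Polynomial.X ^ k : Polynomial K) • snf.bM j ∈ N ∧
      ∀ f ∈ N, (Polynomial.X ^ k : Polynomial K) ∣ snf.bM.repr f j := by
    intro j
    have hj : j ∈ Set.range snf.f := by
      by_contra hj
      have := snf.repr_eq_zero_of_notMem_range ⟨_, hXN (snf.bM j)⟩ hj
      simp at this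
    obtain ⟨i, rfl⟩ := hj
    have hdvd : ∀ f ∈ N, snf.a i ∣ snf.bM.repr f (snf.f i) := by
      intro f hf
      have := snf.repr_apply_embedding_eq_repr_smul (⟨f, hf⟩ : N) (i := i)
      simp only [map_smul, Finsupp.smul_apply, smul_eq_mul] at this
      exact ⟨_, this⟩
    have hX : snf.a i ∣ Polynomial.X ^ r := by
      simpa using hdvd _ (hXN (snf.bM (snf.f i)))
    obtain ⟨k, hkr, hk⟩ := (dvd_prime_pow Polynomial.prime_X r).1 hX
    refine ⟨k, hkr, ?_, fun f hf => hk.symm.dvd.trans (hdvd f hf)⟩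
    obtain ⟨q, hq⟩ := hk.dvd
    rw [hq, mul_comm, mul_smul, ← snf.snf]
    exact N.smul_mem _ (snf.bN i).2
  choose a har haN hadvd using hk
  have hsum : ∀ f, π f = ∑ j, Polynomial.aeval τ (snf.bM.repr f j) (π (snf.bM j)) := by
    intro f
    conv_lhs => rw [← snf.bM.sum_repr f]
    simp only [map_sum, hπ]
  refine ⟨fun j => π (snf.bM j), a, ?_, har, le_antisymm ?_ ?_⟩
  · rw [eq_top_iff]
    rintro x -
    obtain ⟨f, rfl⟩ := hsurj x
    rw [hsum]
    refine Submodule.sum_mem _ fun j _ => hstab _ (fun x hx => apply_mem_truncSpan hx) _ _ ?_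
    exact pow_apply_mem_truncSpan (k := 0) (e := fun j => π (snf.bM j)) le_rfl
  · intro x hx
    obtain ⟨f, rfl⟩ := hsurj x
    rw [hsum]
    refine Submodule.sum_mem _ fun j _ => ?_
    obtain ⟨q, hq⟩ := hadvd j f hx
    rw [hq, mul_comm, map_mul, Module.End.mul_apply]
    refine hstab _ (fun x hx => apply_mem_truncSpan hx) _ _ ?_
    rw [map_pow, Polynomial.aeval_X]
    exact pow_apply_mem_truncSpan (e := fun j => π (snf.bM j)) le_rfl
  · refine truncSpan_le.2 fun i k hk => ?_
    have h : (Polynomial.X ^ k : Polynomial K) • snf.bM i ∈ N := by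
      rw [← Nat.sub_add_cancel hk, pow_add, mul_smul]
      exact N.smul_mem _ (haN i)
    rw [hN, hπ, map_pow, Polynomial.aeval_X] at h
    exact h

end

/-! ### Degenerations between types of stable subspaces -/

section

variable {K V : Type*} [Field K] [AddCommGroup V] [Module K V] {τ : Module.End K V} {d r : ℕ}

/-- The Jordan basis obtained by adding to `c e i` the vector `τ ^ m (e j)`. -/
def shearChain (τ : Module.End K V) (e : Fin d → V) (i j : Fin d) (m : ℕ) (c : K) : Fin d → V :=
  Function.update e i (c • e i + (τ ^ m) (e j))

/-- The type obtained by moving one box from row `j` to row `i`. -/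
def moveBox (a : Fin d → ℕ) (i j : Fin d) : Fin d → ℕ :=
  Function.update (Function.update a i (a i - 1)) j (a j + 1)

/-- The shear is invertible: the chain of `e j` is untouched and can be subtracted, and `c` is a
unit. -/
theorem truncSpan_shearChain_eq_top {e : Fin d → V} (he : truncSpan τ e 0 = ⊤) {i j : Fin d}
    (hij : i ≠ j) (m : ℕ) {c : K} (hc : c ≠ 0) : truncSpan τ (shearChain τ e i j m c) 0 = ⊤ := by
  have hne : ∀ l, l ≠ i → ∀ k, (τ ^ k) (e l) ∈ truncSpan τ (shearChain τ e i j m c) 0 := by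
    intro l hl k
    have h : (τ ^ k) (shearChain τ e i j m c l) ∈ truncSpan τ (shearChain τ e i j m c) 0 :=
      pow_apply_mem_truncSpan (Nat.zero_le k)
    simpa [shearChain, hl] using h
  rw [eq_top_iff, ← he]
  refine truncSpan_le.2 fun l k _ => ?_
  rcases eq_or_ne l i with rfl | hl
  · have h : (τ ^ k) (shearChain τ e l j m c l) ∈ truncSpan τ (shearChain τ e l j m c) 0 :=
      pow_apply_mem_truncSpan (Nat.zero_le k)
    simp only [shearChain, Function.update_self, map_add, map_smul] at h
    rw [← Module.End.mul_apply, ← pow_add] at h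
    exact (Submodule.smul_mem_iff _ hc).1
      ((Submodule.add_mem_iff_left _ (hne j hij.symm (k + m))).1 h)
  · exact hne l hl k

/-- Weight `g = 1` shows that the dimension is preserved; `g l = l` controls the induction measure.
-/
theorem sum_mul_moveBox {a : Fin d → ℕ} {i j : Fin d} (hij : i ≠ j) (hi : 0 < a i) (hir : a i ≤ r)
    (hj : a j < r) (g : Fin d → ℕ) :
    ∑ l, g l * (r - moveBox a i j l) + g j = ∑ l, g l * (r - a l) + g i := by
  have h1 : ∑ l, (if l = j then g l else 0) = g j := by simp
  have h2 : ∑ l, (if l = i then g l else 0) = g i := by simp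
  rw [← h1, ← h2, ← Finset.sum_add_distrib, ← Finset.sum_add_distrib]
  refine Finset.sum_congr rfl fun l _ => ?_
  rcases eq_or_ne l j with rfl | hlj
  · have : r - a l = r - (a l + 1) + 1 := by omega
    simp [moveBox, hij.symm, this, mul_add]
  · rcases eq_or_ne l i with rfl | hli
    · have : r - (a l - 1) = r - a l + 1 := by omega
      simp [moveBox, hlj, this, mul_add]
    · simp [moveBox, hlj, hli]

theorem sum_moveBox {a : Fin d → ℕ} {i j : Fin d} (hij : i ≠ j) (hi : 0 < a i) (hir : a i ≤ r)
    (hj : a j < r) : ∑ l, (r - moveBox a i j l) = ∑ l, (r - a l) := by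
  simpa using sum_mul_moveBox hij hi hir hj fun _ => 1

theorem moveBox_le {a : Fin d → ℕ} {i j : Fin d} (ha : ∀ l, a l ≤ r) (hj : a j < r) (l : Fin d) :
    moveBox a i j l ≤ r := by
  have h1 := ha i
  have h2 := ha l
  rcases eq_or_ne l j with rfl | hlj
  · simpa [moveBox] using hj
  · rcases eq_or_ne l i with rfl | hli
    · simp only [moveBox, ne_eq, hlj, not_false_eq_true, Function.update_of_ne,
        Function.update_self]
      omega
    · simpa [moveBox, hlj, hli] using h2

theorem sum_mul_comp_swap_lt {a : Fin d → ℕ} {i j : Fin d} (hij : i < j) (hi : a i ≤ r)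
    (ha : a j < a i) :
    ∑ l : Fin d, (l : ℕ) * (r - (a ∘ Equiv.swap i j) l) < ∑ l : Fin d, (l : ℕ) * (r - a l) := by
  have key : ∑ l : Fin d, (l : ℕ) * (r - (a ∘ Equiv.swap i j) l) + (i * (r - a i) + j * (r - a j))
      = ∑ l : Fin d, (l : ℕ) * (r - a l) + (i * (r - a j) + j * (r - a i)) := by
    have h : ∀ f : Fin d → ℕ, ∑ l, (if l = i then f l else 0) + ∑ l, (if l = j then f l else 0)
        = f i + f j := by simp
    rw [← h fun l => (l : ℕ) * (r - a l)]
    have h' := h fun l => (l : ℕ) * (r - (a ∘ Equiv.swap i j) l)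
    simp only [Function.comp_apply, Equiv.swap_apply_left, Equiv.swap_apply_right] at h'
    rw [← h', ← Finset.sum_add_distrib, ← Finset.sum_add_distrib, ← Finset.sum_add_distrib,
      ← Finset.sum_add_distrib]
    refine Finset.sum_congr rfl fun l _ => ?_
    rcases eq_or_ne l i with rfl | hli
    · simp [hij.ne, add_comm]
    · rcases eq_or_ne l j with rfl | hlj
      · simp [hij.ne', add_comm]
      · simp [hli, hlj, Equiv.swap_apply_of_ne_of_ne]
  have hij' : (i : ℕ) < j := hij
  -- The measure drops by `(j - i) * (a i - a j)`; the gaps are named to avoid natural subtraction.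
  obtain ⟨x, hx⟩ := Nat.exists_eq_add_of_lt hij'
  have : r - a i < r - a j := by omega
  obtain ⟨y, hy⟩ := Nat.exists_eq_add_of_lt this
  rw [hx, hy] at key
  nlinarith

/-- Along the line through the basis of `truncSpan τ e a` that moves `τ ^ a j (e j)` in the
direction of `τ ^ (a i - 1) (e i)`, the spans are of the type obtained by moving a box from row `j`
to row `i`. -/
theorem truncSpan_shearChain_le (hτ : τ ^ r = 0) (e : Fin d → V) {a : Fin d → ℕ} {i j : Fin d}
    (hij : i ≠ j) (hi : 0 < a i) (hle : a i ≤ a j) (hj : a j < r) (c : K) :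
    truncSpan τ (shearChain τ e i j (a j + 1 - a i) c) (moveBox a i j) ≤
      Submodule.span K (Set.range
        ((fun p : {p : Fin d × Fin r // a p.1 ≤ p.2} => (τ ^ (p.1.2 : ℕ)) (e p.1.1)) +
          c • fun p => if p.1 = (j, ⟨a j, hj⟩) then (τ ^ (a i - 1)) (e i) else 0)) := by
  set W := Submodule.span K (Set.range
        ((fun p : {p : Fin d × Fin r // a p.1 ≤ p.2} => (τ ^ (p.1.2 : ℕ)) (e p.1.1)) +
          c • fun p => if p.1 = (j, ⟨a j, hj⟩) then (τ ^ (a i - 1)) (e i) else 0)) with hW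
  -- All basis vectors but `τ ^ a j (e j)` stay fixed along the line.
  have hmem : ∀ l k, a l ≤ k → (l ≠ j ∨ k ≠ a j) → (τ ^ k) (e l) ∈ W := by
    intro l k hk hne
    by_cases hkr : k < r
    · refine Submodule.subset_span ⟨⟨(l, ⟨k, hkr⟩), hk⟩, ?_⟩
      have : ¬ (l = j ∧ k = a j) := by tauto
      simp [this]
    · rw [pow_apply_eq_zero hτ (not_lt.1 hkr)]
      exact zero_mem _
  have hmem' : (τ ^ a j) (e j) + c • (τ ^ (a i - 1)) (e i) ∈ W :=
    Submodule.subset_span ⟨⟨(j, ⟨a j, hj⟩), le_rfl⟩, by simp⟩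
  refine truncSpan_le.2 fun l k hk => ?_
  rcases eq_or_ne l i with rfl | hli
  · simp only [moveBox, ne_eq, hij, not_false_eq_true, Function.update_of_ne,
      Function.update_self] at hk
    simp only [shearChain, Function.update_self, map_add, map_smul]
    rw [← Module.End.mul_apply, ← pow_add]
    rcases hk.eq_or_lt with rfl | hk'
    -- The shear exponent is chosen so that the first vector of the lengthened chain is exactly the
    -- moving vector.
    · have : a l - 1 + (a j + 1 - a l) = a j := by omega
      rw [this, add_comm]
      exact hmem'
    · exact W.add_mem (W.smul_mem _ (hmem _ _ (by omega) (Or.inl hij)))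
        (hmem _ _ (by omega) (Or.inr (by omega)))
  · simp only [shearChain, ne_eq, hli, not_false_eq_true, Function.update_of_ne]
    rcases eq_or_ne l j with rfl | hlj
    · simp only [moveBox, Function.update_self] at hk
      exact hmem _ _ (by omega) (Or.inr (by omega))
    · simp only [moveBox, ne_eq, hli, hlj, not_false_eq_true, Function.update_of_ne] at hk
      exact hmem _ _ hk (Or.inl hlj)

end

/-- A closed subset of the Grassmannian containing the stable subspaces of the generic type contains
all stable subspaces. -/
theorem plucker_mem_of_eq_truncSpan {K : Type*} [Field K] [Infinite K] {n d r ℓ : ℕ}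
    (hn : n = d * r) {τ : Module.End K (Fin n → K)} (hτ : τ ^ r = 0)
    {Z : Set (Projectivization K ((Fin ℓ ↪o Fin n) → K))} (hZ : IsClosed Z)
    (hgen : ∀ (e : Fin d → Fin n → K) (a : Fin d → ℕ), truncSpan τ e 0 = ⊤ →
      (∀ i j, i < j → a i = 0 ∨ r ≤ a j) → ∀ L : Gr K ℓ n, L.1 = truncSpan τ e a → plucker L ∈ Z)
    (e : Fin d → Fin n → K) (a : Fin d → ℕ) (he : truncSpan τ e 0 = ⊤) (ha : ∀ i, a i ≤ r)
    (L : Gr K ℓ n) (hL : L.1 = truncSpan τ e a) : plucker L ∈ Z := by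
  -- The measure weights each box by its row index, so it falls as boxes move to earlier rows.
  induction hN : ∑ l : Fin d, (l : ℕ) * (r - a l) using Nat.strong_induction_on
    generalizing e a L with
  | _ N ih =>
    by_cases hcase : ∀ i j, i < j → a i = 0 ∨ r ≤ a j
    · exact hgen e a he hcase L hL
    push Not at hcase
    obtain ⟨i, j, hij, hi, hj⟩ := hcase
    replace hi : 0 < a i := Nat.pos_of_ne_zero hi
    have hV : Module.finrank K (Fin n → K) = d * r := by simp [hn]
    have hℓ : ∑ l, (r - a l) = ℓ := by
      rw [← finrank_truncSpan hτ hV he, ← hL, L.2]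
    -- If row `j` is longer, relabelling the chains leaves `L` unchanged and lowers the measure;
    -- otherwise `L` is the limit `c = 0` of box moves.
    rcases lt_or_ge (a j) (a i) with hlt | hge
    · refine ih _ (hN ▸ sum_mul_comp_swap_lt hij (ha i) hlt) (e ∘ Equiv.swap i j)
        (a ∘ Equiv.swap i j) ?_ (fun l => ha _) L ?_ rfl
      · exact (truncSpan_comp_perm e 0 (Equiv.swap i j)).trans he
      · rw [hL, truncSpan_comp_perm]
    · refine plucker_mem_of_line hZ ((card_le_snd a).trans hℓ) _
        (fun p => if p.1 = (j, ⟨a j, hj⟩) then (τ ^ (a i - 1)) (e i) else 0) L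
        (by rw [hL, truncSpan_eq_span_range hτ]) fun c hc => ?_
      have he' := truncSpan_shearChain_eq_top he hij.ne (a j + 1 - a i) hc
      have hfin : Module.finrank K (truncSpan τ (shearChain τ e i j (a j + 1 - a i) c)
          (moveBox a i j)) = ℓ := by
        rw [finrank_truncSpan hτ hV he', sum_moveBox hij.ne hi (ha i) hj, hℓ]
      refine ⟨⟨_, hfin⟩, ?_, ih _ ?_ _ _ he' (moveBox_le ha hj) _ rfl rfl⟩
      · symm
        apply Submodule.eq_of_le_of_finrank_le
          (truncSpan_shearChain_le hτ e hij.ne hi hge hj c)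
        rw [hfin, ← hℓ, ← card_le_snd]
        exact finrank_range_le_card _
      · have := sum_mul_moveBox hij.ne hi (ha i) hj fun l => (l : ℕ)
        have hij' : (i : ℕ) < j := hij
        omega

/-! ### The generic type -/

/-- The matrix with the rows `v₀ T^(r-1), …, v₀ T, v₀, v₁ T^(r-1), …, v₁, …`, up to `ℓ` rows. -/
def chainMatrix {K : Type*} [Field K] {n : ℕ} (T : Matrix (Fin n) (Fin n) K) (r ℓ : ℕ)
    (v : ℕ × Fin n → K) : Matrix (Fin ℓ) (Fin n) K :=
  Matrix.of fun p => Matrix.vecMul (fun m => v (p / r, m)) (T ^ (r - 1 - p % r))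

/-- The maximal minors of `chainMatrix T r ℓ v` as polynomials in the entries of `v`. -/
noncomputable def chainMinors {K : Type*} [Field K] {n : ℕ} (T : Matrix (Fin n) (Fin n) K)
    (r ℓ : ℕ) (I : Fin ℓ ↪o Fin n) : MvPolynomial (ℕ × Fin n) K :=
  (Matrix.of fun p j : Fin ℓ => ∑ m, MvPolynomial.X ((p : ℕ) / r, m) *
    MvPolynomial.C ((T ^ (r - 1 - (p : ℕ) % r)) m (I j))).det

section

variable {K : Type*} [Field K] {n d r ℓ : ℕ} {T : Matrix (Fin n) (Fin n) K}

theorem eval_chainMinors (v : ℕ × Fin n → K) :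
    (fun I => MvPolynomial.eval v (chainMinors T r ℓ I)) = maximalMinors (chainMatrix T r ℓ v) := by
  ext I
  rw [chainMinors, RingHom.map_det]
  congr 1
  ext p j
  simp [chainMatrix, Matrix.vecMul, dotProduct]

theorem vecMulLinear_pow_apply (k : ℕ) (x : Fin n → K) :
    (T.vecMulLinear ^ k) x = Matrix.vecMul x (T ^ k) := by
  induction k generalizing x with
  | zero => simp
  | succ k ih => rw [pow_succ, Module.End.mul_apply, ih, pow_succ', ← Matrix.vecMul_vecMul]; rfl

theorem vecMulLinear_pow_eq_zero (hT : T ^ r = 0) : T.vecMulLinear ^ r = 0 := by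
  refine LinearMap.ext fun x => ?_
  simp [hT, vecMulLinear_pow_apply]

/-- `T` sends each row to the preceding one, or to zero at the start of a chain. Descending powers
make this survive the cut after `ℓ` rows. -/
theorem vecMul_mem_span_chainMatrix (hr : 0 < r) (hT : T ^ r = 0) (v : ℕ × Fin n → K)
    {x : Fin n → K} (hx : x ∈ Submodule.span K (Set.range (chainMatrix T r ℓ v).row)) :
    Matrix.vecMul x T ∈ Submodule.span K (Set.range (chainMatrix T r ℓ v).row) := by
  suffices h : Submodule.span K (Set.range (chainMatrix T r ℓ v).row) ≤
      (Submodule.span K (Set.range (chainMatrix T r ℓ v).row)).comap T.vecMulLinear from h hx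
  rw [Submodule.span_le]
  rintro _ ⟨p, rfl⟩
  change Matrix.vecMul (Matrix.vecMul (fun m => v ((p : ℕ) / r, m)) (T ^ (r - 1 - (p : ℕ) % r))) T ∈
    Submodule.span K (Set.range (chainMatrix T r ℓ v).row)
  rw [Matrix.vecMul_vecMul, ← pow_succ]
  have hlt := Nat.mod_lt p hr
  rcases Nat.eq_zero_or_pos (p % r) with h0 | hpos
  · have : r - 1 - p % r + 1 = r := by omega
    rw [this, hT, Matrix.vecMul_zero]
    exact zero_mem _
  · obtain ⟨q, hq⟩ : ∃ q, (p : ℕ) % r = q + 1 := ⟨p % r - 1, by omega⟩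
    have hp : (p : ℕ) = q + 1 + r * (p / r) := by rw [← hq]; exact (Nat.mod_add_div _ _).symm
    have hp1 : (p : ℕ) - 1 = q + r * (p / r) := by omega
    refine Submodule.subset_span ⟨⟨p - 1, by omega⟩, ?_⟩
    have hmod : ((p : ℕ) - 1) % r = q := by
      rw [hp1, Nat.add_mul_mod_self_left, Nat.mod_eq_of_lt (by omega)]
    have hdiv : ((p : ℕ) - 1) / r = p / r := by
      rw [hp1, Nat.add_mul_div_left _ _ hr, Nat.div_eq_of_lt (by omega), zero_add]
    have he : r - 1 - q = r - 1 - p % r + 1 := by omega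
    change Matrix.vecMul (fun m => v (((p : ℕ) - 1) / r, m)) (T ^ (r - 1 - ((p : ℕ) - 1) % r)) = _
    rw [hmod, hdiv, he]

theorem polynomialImage_chainMinors_subset (hr : 0 < r) (hT : T ^ r = 0) :
    polynomialImage (chainMinors T r ℓ) ⊆ fixedLocus ℓ T := by
  rintro _ ⟨v, hv, rfl⟩
  have hv' := hv
  rw [eval_chainMinors] at hv'
  have hli := linearIndependent_row_of_maximalMinors_ne_zero hv'
  let L : Gr K ℓ n := ⟨Submodule.span K (Set.range (chainMatrix T r ℓ v).row), by
    rw [finrank_span_eq_card hli, Fintype.card_fin]⟩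
  refine ⟨L, fun x hx => vecMul_mem_span_chainMatrix hr hT v hx, ?_⟩
  rw [plucker_eq_mk L _ hli rfl]
  simp only [eval_chainMinors]

theorem mul_add_le_sum {a : Fin d → ℕ} {i : Fin d} (h : ∀ j < i, a j = 0) :
    i * r + (r - a i) ≤ ∑ j, (r - a j) := by
  calc i * r + (r - a i) = ∑ j ∈ Finset.Iio i, (r - a j) + (r - a i) := by
        rw [Finset.sum_congr rfl fun j hj => by rw [h j (Finset.mem_Iio.1 hj)]]
        simp
    _ = ∑ j ∈ insert i (Finset.Iio i), (r - a j) := by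
        rw [Finset.sum_insert (by simp), add_comm]
    _ ≤ ∑ j, (r - a j) := Finset.sum_le_sum_of_subset (Finset.subset_univ _)

theorem plucker_mem_polynomialImage (hn : n = d * r) (hT : T ^ r = 0)
    {e : Fin d → Fin n → K} {a : Fin d → ℕ} (he : truncSpan T.vecMulLinear e 0 = ⊤)
    (ha : ∀ i j, i < j → a i = 0 ∨ r ≤ a j) {L : Gr K ℓ n}
    (hL : L.1 = truncSpan T.vecMulLinear e a) :
    plucker L ∈ polynomialImage (chainMinors T r ℓ) := by
  have hτ : T.vecMulLinear ^ r = 0 := vecMulLinear_pow_eq_zero hT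
  have hℓ : ∑ l, (r - a l) = ℓ := by
    rw [← finrank_truncSpan hτ (by simp [hn]) he, ← hL, L.2]
  let v : ℕ × Fin n → K := fun q => if h : q.1 < d then e ⟨q.1, h⟩ q.2 else 0
  have hle : L.1 ≤ Submodule.span K (Set.range (chainMatrix T r ℓ v).row) := by
    rw [hL]
    refine truncSpan_le.2 fun i k hk => ?_
    by_cases hkr : k < r
    -- Row `i` is nonempty, so all earlier rows are full and chain `i` starts at matrix row `i * r`.
    · have hi : ∀ j < i, a j = 0 := fun j hj => (ha j i hj).resolve_right (by omega)
      have hle := mul_add_le_sum (r := r) hi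
      rw [hℓ] at hle
      have hr : 0 < r := by omega
      have hlt : (i : ℕ) * r + (r - 1 - k) < ℓ := by omega
      refine Submodule.subset_span ⟨⟨i * r + (r - 1 - k), hlt⟩, ?_⟩
      have hdiv : ((i : ℕ) * r + (r - 1 - k)) / r = i := by
        rw [add_comm, Nat.add_mul_div_right _ _ hr, Nat.div_eq_of_lt (by omega), zero_add]
      have hmod : ((i : ℕ) * r + (r - 1 - k)) % r = r - 1 - k := by
        rw [add_comm, Nat.add_mul_mod_self_right, Nat.mod_eq_of_lt (by omega)]
      have hk' : r - 1 - (r - 1 - k) = k := by omega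
      rw [vecMulLinear_pow_apply]
      change Matrix.vecMul (fun m => v (((i : ℕ) * r + (r - 1 - k)) / r, m))
        (T ^ (r - 1 - ((i : ℕ) * r + (r - 1 - k)) % r)) = _
      rw [hdiv, hmod, hk']
      simp [v]
    · rw [pow_apply_eq_zero hτ (not_lt.1 hkr)]
      exact zero_mem _
  have heq : L.1 = Submodule.span K (Set.range (chainMatrix T r ℓ v).row) := by
    apply Submodule.eq_of_le_of_finrank_le hle
    rw [L.2]
    exact (finrank_range_le_card _).trans (Fintype.card_fin ℓ).le
  have hli : LinearIndependent K (chainMatrix T r ℓ v).row := by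
    rw [linearIndependent_iff_card_eq_finrank_span, Set.finrank, ← heq, L.2, Fintype.card_fin]
  have hv : (fun I => MvPolynomial.eval v (chainMinors T r ℓ I)) ≠ 0 := by
    rw [eval_chainMinors]
    exact maximalMinors_ne_zero _ hli
  refine ⟨v, hv, ?_⟩
  rw [plucker_eq_mk L _ hli heq.symm]
  simp only [eval_chainMinors]

/-- The variety of subspaces stable under a nilpotent matrix with `d` Jordan blocks of size `r` is
irreducible. -/
theorem isIrreducible_fixedLocus [Infinite K] (hr : 0 < r) (hn : n = d * r) (hT : T ^ r = 0)
    {e₀ : Fin d → Fin n → K} (he₀ : truncSpan T.vecMulLinear e₀ 0 = ⊤) (hℓ : ℓ ≤ n) :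
    IsIrreducible (fixedLocus ℓ T) := by
  have hτ : T.vecMulLinear ^ r = 0 := vecMulLinear_pow_eq_zero hT
  have hsub : fixedLocus ℓ T ⊆ closure (polynomialImage (chainMinors T r ℓ)) := by
    rintro _ ⟨L, hL, rfl⟩
    obtain ⟨e, a, he, ha, hLa⟩ := exists_eq_truncSpan hτ he₀ L.1 hL
    exact plucker_mem_of_eq_truncSpan hn hτ isClosed_closure
      (fun e a he ha L hL => subset_closure (plucker_mem_polynomialImage hn hT he ha hL))
      e a he ha L hLa
  have hirr : IsPreirreducible (fixedLocus ℓ T) := by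
    -- The fixed locus and the polynomial family have the same closure, which decides
    -- preirreducibility.
    rw [← isPreirreducible_iff_closure, (closure_minimal hsub isClosed_closure).antisymm
      (closure_mono (polynomialImage_chainMinors_subset hr hT)), isPreirreducible_iff_closure]
    exact isPreirreducible_polynomialImage _
  refine ⟨?_, hirr⟩
  -- Greedy filling: with truncated subtraction, row `i` has length `min r (ℓ - i * r)`.
  let a : Fin d → ℕ := fun i => r - (ℓ - i * r)
  have ha : Module.finrank K (truncSpan T.vecMulLinear e₀ a) = ℓ := by
    rw [finrank_truncSpan hτ (by simp [hn]) he₀]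
    have : ∀ d : ℕ, ∑ i ∈ Finset.range d, (r - (r - (ℓ - i * r))) = min ℓ (d * r) := by
      intro d
      induction d with
      | zero => simp
      | succ d ih => rw [Finset.sum_range_succ, ih, Nat.succ_mul]; omega
    rw [Fin.sum_univ_eq_sum_range (fun i => r - (r - (ℓ - i * r))) d, this]
    omega
  exact ⟨_, ⟨_, ha⟩, fun x hx => apply_mem_truncSpan hx, rfl⟩

end

/-! ### The Jordan matrix of a rectangular partition -/

theorem jordanNilpotent_map (K : Type*) [Field K] {F : Type*} [Field F] [Algebra K F] {n : ℕ}
    (lam : n.Partition) :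
    (jordanNilpotent K lam).map (algebraMap K F) = jordanNilpotent F lam := by
  ext i j
  simp only [jordanNilpotent, Matrix.map_apply, Matrix.of_apply]
  split_ifs <;> simp

section

variable {K : Type*} [Field K] {n d r : ℕ} {lam : n.Partition}

theorem eq_mul_of_parts_eq_replicate (h : lam.parts = Multiset.replicate d r) : n = d * r := by
  rw [← lam.parts_sum, h]; simp

theorem jordanNilpotent_apply (h : lam.parts = Multiset.replicate d r) (i j : Fin n) :
    jordanNilpotent K lam i j = if (j : ℕ) = i + 1 ∧ ¬ r ∣ i + 1 then 1 else 0 := by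
  have hn := eq_mul_of_parts_eq_replicate h
  have hsort : lam.parts.sort (fun a b => a ≥ b) = List.replicate d r := by
    rw [List.eq_replicate_iff, Multiset.length_sort, h]
    refine ⟨by simp, fun b hb => ?_⟩
    rw [Multiset.mem_sort] at hb
    exact Multiset.eq_of_mem_replicate hb
  have hi : (i : ℕ) + 1 ≤ d * r := by omega
  rw [jordanNilpotent, Matrix.of_apply, hsort]
  have key : (∀ k, (i : ℕ) + 1 ≠ ((List.replicate d r).take k).sum) ↔ ¬ r ∣ i + 1 := by
    simp only [List.take_replicate, List.sum_replicate, smul_eq_mul]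
    constructor
    · rintro hk ⟨q, hq⟩
      -- `take` saturates at `d` parts, so a multiple `q * r` is a partial sum `take q` only for `q
      -- ≤ d`.
      have hqd : q ≤ d := by
        by_contra hqd
        have hr : 0 < r := Nat.pos_of_ne_zero (by rintro rfl; omega)
        have : (d + 1) * r ≤ q * r := Nat.mul_le_mul_right r (by omega)
        rw [Nat.succ_mul] at this
        rw [mul_comm] at hq
        omega
      exact hk q (by rw [hq, min_eq_left hqd, mul_comm])
    · intro hk q hq
      exact hk ⟨_, hq.trans (mul_comm _ _)⟩
  simp only [key]

theorem single_vecMul_jordanNilpotent (h : lam.parts = Multiset.replicate d r) {i : Fin n} {m : ℕ}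
    (hm : (i : ℕ) = m) :
    Matrix.vecMul (Pi.single i 1) (jordanNilpotent K lam) = fun j : Fin n =>
      if (j : ℕ) = m + 1 ∧ ¬ r ∣ m + 1 then (1 : K) else 0 := by
  ext j
  rw [Matrix.single_one_vecMul, Matrix.row, jordanNilpotent_apply h, hm]

/-- A basis vector shifts right until it leaves its block; `i % r` is its position there. -/
theorem single_vecMul_jordanNilpotent_pow (h : lam.parts = Multiset.replicate d r) (i : Fin n)
    (k : ℕ) :
    Matrix.vecMul (Pi.single i 1) (jordanNilpotent K lam ^ k) = fun j : Fin n =>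
      if (j : ℕ) = i + k ∧ (i : ℕ) % r + k < r then (1 : K) else 0 := by
  have hn := eq_mul_of_parts_eq_replicate h
  have hr : 0 < r := Nat.pos_of_ne_zero (by rintro rfl; have := i.2; simp at hn; omega)
  have hmod := Nat.mod_lt i hr
  induction k with
  | zero =>
    ext j
    simp [Pi.single_apply, Fin.ext_iff, hmod]
  | succ k ih =>
    rw [pow_succ, ← Matrix.vecMul_vecMul, ih]
    by_cases hk : (i : ℕ) % r + k < r
    · have hlt : (i : ℕ) + k < n := by
        have h1 := Nat.mod_add_div i r
        have h2 : (i : ℕ) / r < d := Nat.div_lt_of_lt_mul (by rw [mul_comm, ← hn]; exact i.2)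
        have h3 : r * (i / r + 1) ≤ r * d := Nat.mul_le_mul_left r h2
        rw [mul_add, mul_comm r d, ← hn] at h3
        omega
      have hs : (fun j : Fin n => if (j : ℕ) = i + k ∧ (i : ℕ) % r + k < r then (1 : K) else 0)
          = Pi.single ⟨i + k, hlt⟩ 1 := by
        ext j
        simp [Pi.single_apply, Fin.ext_iff, hk]
      rw [hs, single_vecMul_jordanNilpotent h (m := i + k) rfl]
      ext j
      refine if_congr (and_congr_right fun _ => ?_) rfl rfl
      have : (i : ℕ) + k + 1 = (i % r + k + 1) + r * (i / r) := by
        have := Nat.mod_add_div i r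
        omega
      rw [this, Nat.dvd_add_left (dvd_mul_right _ _)]
      constructor
      · intro hd
        rcases (Nat.succ_le_of_lt hk).eq_or_lt with heq | hlt
        · exact absurd (dvd_of_eq heq.symm) hd
        · exact hlt
      · intro hlt hd
        exact absurd (Nat.le_of_dvd (by omega) hd) (by omega)
    · have hk' : ¬ (i : ℕ) % r + (k + 1) < r := by omega
      ext j
      simp [hk, hk', Matrix.vecMul, dotProduct]

theorem jordanNilpotent_pow_eq_zero (h : lam.parts = Multiset.replicate d r) :
    jordanNilpotent K lam ^ r = 0 := by
  ext i j
  have := congrFun (single_vecMul_jordanNilpotent_pow (K := K) h i r) j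
  simpa using this

theorem exists_truncSpan_jordanNilpotent_eq_top (h : lam.parts = Multiset.replicate d r) :
    ∃ e : Fin d → Fin n → K, truncSpan (jordanNilpotent K lam).vecMulLinear e 0 = ⊤ := by
  have hn := eq_mul_of_parts_eq_replicate h
  let e : Fin d → Fin n → K := fun i m => if (m : ℕ) = i * r then 1 else 0
  refine ⟨e, ?_⟩
  rw [eq_top_iff, ← (Pi.basisFun K (Fin n)).span_eq, Submodule.span_le]
  rintro _ ⟨j, rfl⟩
  have hj := j.2
  have hr : 0 < r := Nat.pos_of_ne_zero (by rintro rfl; simp at hn; omega)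
  have hd : (j : ℕ) / r < d := Nat.div_lt_of_lt_mul (by rw [mul_comm, ← hn]; exact hj)
  have hdm := Nat.div_add_mod' j r
  have hmod := Nat.mod_lt j hr
  have he : e ⟨j / r, hd⟩ = Pi.single ⟨j / r * r, by omega⟩ 1 := by
    ext m
    simp [e, Pi.single_apply, Fin.ext_iff]
  have hmem : ((jordanNilpotent K lam).vecMulLinear ^ (j % r : ℕ)) (e ⟨j / r, hd⟩) ∈
      truncSpan (jordanNilpotent K lam).vecMulLinear e 0 := pow_apply_mem_truncSpan (Nat.zero_le _)
  rw [vecMulLinear_pow_apply, he, single_vecMul_jordanNilpotent_pow h] at hmem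
  have : (Pi.basisFun K (Fin n)) j = fun m : Fin n =>
      if (m : ℕ) = j / r * r + j % r ∧ (j / r * r) % r + j % r < r then (1 : K) else 0 := by
    ext m
    simp [Pi.single_apply, Fin.ext_iff, hdm, hmod]
  rw [this]
  exact hmem

theorem isIrreducible_fixedLocus_jordanNilpotent [Infinite K] (hlam : IsRectangular lam) {ℓ : ℕ}
    (hℓ : ℓ ≤ n) : IsIrreducible (fixedLocus ℓ (jordanNilpotent K lam)) := by
  obtain ⟨d, r, -, hr, h⟩ := hlam
  obtain ⟨e, he⟩ := exists_truncSpan_jordanNilpotent_eq_top (K := K) h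
  exact isIrreducible_fixedLocus (by omega) (eq_mul_of_parts_eq_replicate h)
    (jordanNilpotent_pow_eq_zero h) he hℓ

end

/-- For a rectangular partition `λ` of `n` and `0 ≤ ℓ ≤ n`, the variety `Gr(ℓ,n)^{T_λ}` over a field
`K` is irreducible: its set of geometric points is irreducible in the Zariski topology, and so is its
set of `K`-points if `K` is infinite. -/
theorem mainTheorem2 (K : Type*) [Field K] {n : ℕ} (lam : n.Partition) (hlam : IsRectangular lam)
    (ℓ : ℕ) (hℓ : ℓ ≤ n) :
    IsIrreducible (fixedLocus ℓ
      ((jordanNilpotent K lam).map (algebraMap K (AlgebraicClosure K)))) ∧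
    (Infinite K → IsIrreducible (fixedLocus ℓ (jordanNilpotent K lam))) := by
  refine ⟨?_, fun _ => isIrreducible_fixedLocus_jordanNilpotent hlam hℓ⟩
  have : Infinite (AlgebraicClosure K) := IsAlgClosed.instInfinite
  rw [jordanNilpotent_map]
  exact isIrreducible_fixedLocus_jordanNilpotent hlam hℓ
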